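/- **Theorem (Separating UPT circuits and ABPs under shuffling).** For integers $m\ge 1$, $d\ge 0$ let $T_d$ be the complete binary tree of depth $d$, let $D=2^{d+1}-1$ be its number of nodes and $v_1,\dots,v_D$ its nodes in in-order (left subtree, root, right subtree, recursively). A colouring $\gamma:T_d\to\mathbb Z_m$ is *legal* if $\gamma(u)=\gamma(v)+\gamma(w)$ in $\mathbb Z_m$ for every node $u$ with children $v,w$. Over a field $\mathbb F$, in non-commuting variables $x_a$ ($a\in\mathbb Z_m$), let $$P_d=\sum_{\gamma\ \text{legal}}x_{\gamma(v_1)}x_{\gamma(v_2)}\cdots x_{\gamma(v_D)} .$$ For $\sigma\in S_D$ let $\Delta_\sigma$ be the linear map on homogeneous polynomials of degree $D$ given by $\Delta_\sigma(x_{w_1}\cdots x_{w_D})=x_{w_{\sigma(1)}}\cdots x_{w_{\sigma(D)}}$. A *UPT circuit* is a non-commutative arithmetic circuit that computes a homogeneous polynomial and all of whose parse trees (keep the output gate, keep one child of every kept $+$ gate and all children, in order, of every kept $\times$ gate) have the same shape, i.e. differ only in gate names. Its size is the number of gates plus the number of wires; its *preimage-width* is the maximum, over positions $\tau$ of that shape,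 of the number of gates that occur at $\tau$ in some parse tree. A non-commutative *algebraic branching program* (ABP) is a finite directed acyclic graph with a source, a sink and edges labelled by affine forms, computing the sum over all source–sink paths of the ordered product of the labels; its size is its number of vertices. If it is homogeneous and layered (the vertices are partitioned into layers, the source is in layer $0$, edges go from each layer to the next, and labels are homogeneous linear forms), its *width* is the largest number of vertices in a layer. There are a real constant $c>0$ and a natural number $C$ such that for every field $\mathbb F$ and every $m\ge1$ the following hold. 1. For every $d\ge 1$, the polynomial $P_d$ is non-zero and homogeneous of degree $D=2^{d+1}-1$; it is computed by a UPT circuit of size at most $C\,m^2 d$; and for every $\sigma\in S_D$, every ABP computing $\Delta_\sigma(P_d)$ has size at least $m^{c d}$, and, if it is homogeneous and layered, width at least $m^{c d}$. 2. If $m\ge 2$, $d=\lfloor\log_2 m\rfloor$ and $D=2^{d+1}-1$, then the $m$-variate degree-$D$ polynomial $P_d$ is computed by a UPT circuit of size at most $C\,m^2\log_2 m$ and preimage-width at most $(mD)^{C}$; and for every $\sigma\in S_D$, every ABP computing $\Delta_\sigma(P_d)$ has size at least $(mD)^{c\log_2(mD)}$, and, if it is homogeneous and layered, width at least $(mD)^{c\log_2(mD)}$.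 -/

import Mathlib

namespace NCShuffle

/-! ### Non-commutative polynomials and shufflings -/

/-- The ring `F⟨X⟩` of polynomials in the non-commuting variables `X`: finite `F`-linear
combinations of words over `X`, multiplied by concatenation. -/
abbrev NCPoly (F : Type*) [Field F] (X : Type*) := MonoidAlgebra F (FreeMonoid X)

/-- `f` is homogeneous of degree `n`: every word occurring in `f` has length `n`. -/
def IsHomogeneous {F : Type*} [Field F] {X : Type*} (f : NCPoly F X) (n : ℕ) : Prop :=
  ∀ w : FreeMonoid X, f.coeff w ≠ 0 → w.length = n

/-- Permuting the letters of a word of length `n`: the `i`-th letter of the new word is the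
`σ i`-th letter of `w`. Words of any other length are left alone. -/
def shuffleWord {X : Type*} {n : ℕ} (σ : Equiv.Perm (Fin n)) (w : FreeMonoid X) : FreeMonoid X :=
  if h : w.toList.length = n then
    FreeMonoid.ofList (List.ofFn fun i : Fin n => w.toList.get ((σ i).cast h.symm))
  else w

/-- The shuffling `Δ_σ`: the linear extension of `shuffleWord σ`. (It is only of interest on
polynomials that are homogeneous of degree `n`.) -/
noncomputable def shuffle {F : Type*} [Field F] {X : Type*} {n : ℕ} (σ : Equiv.Perm (Fin n))
    (f : NCPoly F X) : NCPoly F X :=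
  MonoidAlgebra.mapDomain (shuffleWord σ) f

/-! ### Legal colourings of the complete binary tree -/

/-- The nodes of the complete binary tree of depth `d`. -/
inductive Node : ℕ → Type
  | root {d : ℕ} : Node d
  | left {d : ℕ} (v : Node d) : Node (d + 1)
  | right {d : ℕ} (v : Node d) : Node (d + 1)
  deriving DecidableEq

/-- The nodes in in-order: left subtree, root, right subtree. -/
def inorder : (d : ℕ) → List (Node d)
  | 0 => [Node.root]
  | d + 1 => (inorder d).map Node.left ++ Node.root :: (inorder d).map Node.right

theorem mem_inorder : ∀ {d : ℕ} (v : Node d), v ∈ inorder d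
  | 0, .root => by simp [inorder]
  | _ + 1, .root => by simp [inorder]
  | _ + 1, .left v => by simp [inorder, mem_inorder v]
  | _ + 1, .right v => by simp [inorder, mem_inorder v]

instance (d : ℕ) : Fintype (Node d) := Fintype.ofList (inorder d) mem_inorder

/-- A colouring by `ℤ/m` is legal if the colour of every inner node is the sum of the colours of
its two children: at the root of the tree, and recursively in the left and right subtrees. -/
def IsLegal {m : ℕ} : (d : ℕ) → (Node d → ZMod m) → Prop
  | 0, _ => True
  | d + 1, γ =>
    γ Node.root = γ (Node.left Node.root) + γ (Node.right Node.root) ∧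
      IsLegal d (fun v => γ (Node.left v)) ∧ IsLegal d (fun v => γ (Node.right v))

open Classical in
/-- The polynomial `P_d` in the variables `x_a`, `a ∈ ℤ/m`: the sum over all legal colourings `γ`
of the word `x_{γ(v₁)} ⋯ x_{γ(v_D)}`, where `v₁, …, v_D` are the nodes in in-order. -/
noncomputable def treePoly (F : Type*) [Field F] (m : ℕ) [NeZero m] (d : ℕ) :
    NCPoly F (ZMod m) :=
  ∑ γ : Node d → ZMod m with IsLegal d γ,
    MonoidAlgebra.single (FreeMonoid.ofList ((inorder d).map γ)) (1 : F)

/-! ### Non-commutative arithmetic circuits and parse trees -/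

/-- The gates of a circuit whose gates are named by `Fin s`. The children are listed in order;
both kinds of inner gates may have any fan-in. -/
inductive Gate (F X : Type*) (s : ℕ)
  | var (x : X)
  | const (a : F)
  | add (l : List (Fin s))
  | mul (l : List (Fin s))

/-- The type of a gate, with gate names and leaf labels forgotten. -/
inductive GateKind
  | var
  | const
  | add
  | mul

namespace Gate

variable {F X : Type*} {s : ℕ}

def children : Gate F X s → List (Fin s)
  | var _ => []
  | const _ => []
  | add l => l
  | mul l => l

def kind : Gate F X s → GateKind
  | var _ => .var
  | const _ => .const
  | add _ => .add
  | mul _ => .mul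

end Gate

/-- A non-commutative arithmetic circuit: a directed acyclic graph of gates, named in a
topological order, with an output gate `root`. Inner gates have at least one child. -/
structure Circuit (F X : Type*) where
  numGates : ℕ
  gate : Fin numGates → Gate F X numGates
  root : Fin numGates
  acyclic : ∀ g, ∀ h ∈ (gate g).children, h < g
  add_ne_nil : ∀ g, gate g ≠ Gate.add []
  mul_ne_nil : ∀ g, gate g ≠ Gate.mul []

/-- Finite ordered rooted trees with labelled nodes. -/
inductive LTree (α : Type*)
  | node (a : α) (ts : List (LTree α)) : LTree α

/-- The label of the node at the address `τ` (a list of child indices, read from the root). -/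
def LTree.labelAt {α : Type*} : LTree α → List ℕ → Option α
  | node a _, [] => some a
  | node _ ts, i :: τ =>
    match ts[i]? with
    | none => none
    | some t => t.labelAt τ

namespace Circuit

variable {F X : Type*}

/-- The size of a circuit: the number of gates plus the number of wires. -/
def size (C : Circuit F X) : ℕ :=
  C.numGates + ∑ g, (C.gate g).children.length

/-- The polynomial computed at a gate. -/
noncomputable def value [Field F] (C : Circuit F X) (g : Fin C.numGates) : NCPoly F X :=
  match hg : C.gate g with
  | .var x => MonoidAlgebra.single (FreeMonoid.of x) 1
  | .const a => MonoidAlgebra.single 1 a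
  | .add l => (l.attach.map fun h => C.value h.1).sum
  | .mul l => (l.attach.map fun h => C.value h.1).prod
termination_by g
decreasing_by
  all_goals exact C.acyclic g h.1 (by rw [hg]; exact h.2)

theorem value_eq [Field F] (C : Circuit F X) (g : Fin C.numGates) :
    C.value g =
      match C.gate g with
      | .var x => MonoidAlgebra.single (FreeMonoid.of x) 1
      | .const a => MonoidAlgebra.single 1 a
      | .add l => (l.map C.value).sum
      | .mul l => (l.map C.value).prod := by
  rw [value]
  split <;> rename_i h <;> simp [h]

/-- The polynomial computed by the circuit. -/
noncomputable def poly [Field F] (C : Circuit F X) : NCPoly F X := C.value C.root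

/-- `C.IsParseTree g t`: the tree `t`, labelled by gates, is a parse tree of `C` rooted at the
gate `g`. A sum gate keeps exactly one of its children, a product gate keeps all of them, in the
same order. -/
inductive IsParseTree (C : Circuit F X) : Fin C.numGates → LTree (Fin C.numGates) → Prop
  | var (g : Fin C.numGates) (x : X) (hg : C.gate g = Gate.var x) :
      IsParseTree C g (LTree.node g [])
  | const (g : Fin C.numGates) (a : F) (hg : C.gate g = Gate.const a) :
      IsParseTree C g (LTree.node g [])
  | add (g : Fin C.numGates) (l : List (Fin C.numGates)) (hg : C.gate g = Gate.add l)
      (h : Fin C.numGates) (hh : h ∈ l) (t : LTree (Fin C.numGates)) (ht : IsParseTree C h t) :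
      IsParseTree C g (LTree.node g [t])
  | mul (g : Fin C.numGates) (l : List (Fin C.numGates)) (hg : C.gate g = Gate.mul l)
      (ts : List (LTree (Fin C.numGates))) (hts : List.Forall₂ (IsParseTree C) l ts) :
      IsParseTree C g (LTree.node g ts)

/-- Two trees labelled by gates have the same shape: they have nodes at the same addresses, and
the gates at each address are of the same kind. They may differ only in the gate names. -/
def SameShape (C : Circuit F X) (t t' : LTree (Fin C.numGates)) : Prop :=
  ∀ τ : List ℕ,
    (t.labelAt τ).map (fun g => (C.gate g).kind) = (t'.labelAt τ).map (fun g => (C.gate g).kind)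

/-- Unique-parse-tree circuits: the circuit computes a homogeneous polynomial, and all its parse
trees have the same shape. -/
def IsUPT [Field F] (C : Circuit F X) : Prop :=
  (∃ n, IsHomogeneous C.poly n) ∧
    ∀ t t', C.IsParseTree C.root t → C.IsParseTree C.root t' → C.SameShape t t'

/-- The preimages of the position `τ`: the gates that appear in position `τ` in some parse tree. -/
def preimages (C : Circuit F X) (τ : List ℕ) : Set (Fin C.numGates) :=
  {g | ∃ t, C.IsParseTree C.root t ∧ t.labelAt τ = some g}

/-- The largest number of preimages of a position. (The supremum is over a set of numbers that
are at most the number of gates.) -/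
noncomputable def preimageWidth (C : Circuit F X) : ℕ :=
  ⨆ τ : List ℕ, (C.preimages τ).ncard

theorem bddAbove_preimages (C : Circuit F X) :
    BddAbove (Set.range fun τ : List ℕ => (C.preimages τ).ncard) :=
  ⟨C.numGates, by
    rintro _ ⟨τ, rfl⟩
    simpa using Set.ncard_le_ncard (Set.subset_univ (C.preimages τ))⟩

end Circuit

/-! ### Non-commutative algebraic branching programs -/

/-- A non-commutative algebraic branching program: a directed acyclic graph with a source and a
sink, whose vertices are numbered in a topological order and whose edges `u → v` carry affine
forms `cst u v + ∑ x, lin u v x · x`. (A missing edge is one with label `0`.) -/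
structure ABP (F : Type*) [Field F] (X : Type*) where
  size : ℕ
  source : Fin size
  sink : Fin size
  cst : Fin size → Fin size → F
  lin : Fin size → Fin size → X → F
  acyclic : ∀ u v, ¬ u < v → cst u v = 0 ∧ lin u v = 0

namespace ABP

variable {F : Type*} [Field F] {X : Type*}

/-- The matrix of edge labels. -/
noncomputable def label [Fintype X] (A : ABP F X) :
    Matrix (Fin A.size) (Fin A.size) (NCPoly F X) :=
  Matrix.of fun u v =>
    MonoidAlgebra.single 1 (A.cst u v) +
      ∑ x, MonoidAlgebra.single (FreeMonoid.of x) (A.lin u v x)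

/-- The polynomial computed by the program: the sum, over all directed paths from the source to
the sink, of the product of the labels along the path. The paths of length `k` contribute the
`(source, sink)` entry of the `k`-th power of the matrix of labels, and no path has more than
`size - 1` edges. -/
noncomputable def poly [Fintype X] (A : ABP F X) : NCPoly F X :=
  ∑ k ∈ Finset.range A.size, (A.label ^ k) A.source A.sink

/-- The program is homogeneous and layered: its vertices are arranged in layers, the source in
layer `0`, edges go from one layer to the next, and all labels are homogeneous linear forms. -/
structure Layering (A : ABP F X) where
  layer : Fin A.size → ℕ
  layer_source : layer A.source = 0
  layer_succ : ∀ u v, A.lin u v ≠ 0 → layer v = layer u + 1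
  cst_eq_zero : ∀ u v, A.cst u v = 0

/-- The width of a layered program: the largest number of vertices in a layer. -/
def Layering.width {A : ABP F X} (L : A.Layering) : ℕ :=
  Finset.univ.sup fun v : Fin A.size => (Finset.univ.filter fun u => L.layer u = L.layer v).card

end ABP

end NCShuffle

open NCShuffle

namespace NCShuffle

/-! ### Nisan's rank bound for branching programs with affine labels -/

namespace ABP

variable {F : Type*} [Field F] {X : Type*}

/-! The upper bound is dynamic programming: the part of `treePoly` with root colour `a` satisfies a
convolution over the colour of the left child (`rootedPoly_succ`), and the resulting circuit is UPT
because its shape depends only on the level.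

The lower bound is Nisan's rank argument. Cutting words after a fixed prefix factors the coefficient
matrix of an ABP through its vertices, or through one layer (`card_le_of_transfer`). So it suffices
to find, for each order of the nodes, an initial segment `S` and many legal colourings such that
taking the values of one on `S` and of another off `S` is never legal: their prefixes and suffixes
give an identity submatrix.

Two facts provide them. Some initial segment cuts linearly many in `d` of the triples (inner node,
two children), by an induction that descends two levels and takes the median of three thresholds
(`exists_le_cutCount`). Every cut triple has a node alone on its side, whose colour is forced by the
other two. For a quarter of the cut triples the lone nodes are all left children (or the root) or
all right children, and such nodes can be coloured freely (`exists_fooling`). This gives `m ^ t`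
colourings with `8 * t ≥ d`. For `d = ⌊log₂ m⌋` both `m` and `D` are powers of two up to bounded
factors in the exponent, so the bound becomes quasipolynomial in `m D`. -/

theorem label_of_not_lt [Fintype X] (A : ABP F X) {u v : Fin A.size} (h : ¬ u < v) :
    A.label u v = 0 := by
  obtain ⟨h1, h2⟩ := A.acyclic u v h
  simp [label, h1, h2]

theorem label_pow_ne_zero [Fintype X] (A : ABP F X) (k : ℕ) {u v : Fin A.size}
    (h : (A.label ^ k) u v ≠ 0) : (u : ℕ) + k ≤ v := by
  induction k generalizing u with
  | zero =>
    by_contra hlt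
    exact h (Matrix.one_apply_ne (fun e => hlt (by simp [e])))
  | succ k ih =>
    rw [pow_succ', Matrix.mul_apply] at h
    obtain ⟨p, -, hp⟩ := Finset.exists_ne_zero_of_sum_ne_zero h
    have h1 : u < p := by
      by_contra hn
      exact hp (by rw [A.label_of_not_lt hn, zero_mul])
    have h2 := ih (right_ne_zero_of_mul hp)
    have h3 : (u : ℕ) < p := h1
    omega

theorem label_pow_size [Fintype X] (A : ABP F X) : A.label ^ A.size = 0 := by
  ext1 u v
  by_contra h
  have := A.label_pow_ne_zero _ h
  omega

/-- The matrix of the polynomials computed between any two vertices. -/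
noncomputable def pathSum [Fintype X] (A : ABP F X) :
    Matrix (Fin A.size) (Fin A.size) (NCPoly F X) :=
  ∑ k ∈ Finset.range A.size, A.label ^ k

theorem poly_eq_pathSum [Fintype X] (A : ABP F X) : A.poly = A.pathSum A.source A.sink := by
  simp [poly, pathSum, Matrix.sum_apply]

theorem pathSum_eq [Fintype X] (A : ABP F X) : A.pathSum = 1 + A.label * A.pathSum := by
  have h := mul_geom_sum A.label A.size
  rw [A.label_pow_size, sub_mul, one_mul, zero_sub] at h
  rw [pathSum, sub_eq_iff_eq_add.1 h, add_neg_cancel_left]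

/-- The coefficients of a fixed word in the polynomials computed between any two vertices. -/
noncomputable def coeffMatrix [Fintype X] (A : ABP F X) (w : FreeMonoid X) :
    Matrix (Fin A.size) (Fin A.size) F :=
  Matrix.of fun u v => (A.pathSum u v).coeff w

theorem coeff_label_mul_of [Fintype X] (A : ABP F X) (u v : Fin A.size) (f : NCPoly F X)
    (x : X) (w : FreeMonoid X) :
    (A.label u v * f).coeff (FreeMonoid.of x * w) =
      A.cst u v * f.coeff (FreeMonoid.of x * w) + A.lin u v x * f.coeff w := by
  classical
  have h : ∀ y, (MonoidAlgebra.single (FreeMonoid.of y) (A.lin u v y) * f).coeff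
      (FreeMonoid.of x * w) = if y = x then A.lin u v x * f.coeff w else 0 := by
    intro y
    split_ifs with hy
    · subst hy
      exact MonoidAlgebra.coeff_single_mul_mul ..
    · refine MonoidAlgebra.coeff_single_mul_of_forall_mul_ne _ _ fun d hd => hy ?_
      have := congrArg FreeMonoid.toList hd
      simp only [FreeMonoid.toList_of_mul, List.cons.injEq] at this
      exact this.1
  simp only [label, Matrix.of_apply, add_mul, Finset.sum_mul, MonoidAlgebra.coeff_add,
    MonoidAlgebra.coeff_sum, Finsupp.add_apply, Finsupp.finsetSum_apply, h,
    MonoidAlgebra.coeff_single_one_mul]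
  simp

theorem coeff_label_mul_one [Fintype X] (A : ABP F X) (u v : Fin A.size) (f : NCPoly F X) :
    (A.label u v * f).coeff 1 = A.cst u v * f.coeff 1 := by
  have h : ∀ y, (MonoidAlgebra.single (FreeMonoid.of y) (A.lin u v y) * f).coeff 1 = 0 := by
    intro y
    refine MonoidAlgebra.coeff_single_mul_of_forall_mul_ne _ _ fun d hd => ?_
    have := congrArg FreeMonoid.toList hd
    simp at this
  simp only [label, Matrix.of_apply, add_mul, Finset.sum_mul, MonoidAlgebra.coeff_add,
    MonoidAlgebra.coeff_sum, Finsupp.add_apply, Finsupp.finsetSum_apply, h,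
    MonoidAlgebra.coeff_single_one_mul]
  simp

/-- The coefficient of the empty word in `pathSum_eq`. Constant labels are thereby summed up in one
invertible matrix, so no prior homogenisation is needed. -/
theorem one_sub_cst_mul_coeffMatrix_one [Fintype X] (A : ABP F X) :
    (1 - Matrix.of A.cst) * A.coeffMatrix 1 = 1 := by
  have h : A.coeffMatrix 1 = 1 + Matrix.of A.cst * A.coeffMatrix 1 := by
    ext u v
    conv_lhs => rw [coeffMatrix, Matrix.of_apply, pathSum_eq]
    simp only [Matrix.add_apply, Matrix.mul_apply, MonoidAlgebra.coeff_add, Finsupp.add_apply,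
      MonoidAlgebra.coeff_sum, Finsupp.finsetSum_apply, coeff_label_mul_one, coeffMatrix,
      Matrix.of_apply]
    congr 1
    rcases eq_or_ne u v with rfl | huv
    · simp
    · simp [Matrix.one_apply_ne huv]
  rw [sub_mul, one_mul, sub_eq_iff_eq_add]
  exact h

/-- A path spelling a word first runs along constant edges, then reads its first letter.
Algebraically: take coefficients in `pathSum_eq` and solve for the left side by inverting `1 - cst`.
-/
theorem coeffMatrix_of_mul [Fintype X] (A : ABP F X) (x : X) (w : FreeMonoid X) :
    A.coeffMatrix (FreeMonoid.of x * w) =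
      A.coeffMatrix 1 * Matrix.of (fun u v => A.lin u v x) * A.coeffMatrix w := by
  have h : A.coeffMatrix (FreeMonoid.of x * w) =
      Matrix.of A.cst * A.coeffMatrix (FreeMonoid.of x * w) +
        Matrix.of (fun u v => A.lin u v x) * A.coeffMatrix w := by
    ext u v
    conv_lhs => rw [coeffMatrix, Matrix.of_apply, pathSum_eq]
    simp only [Matrix.add_apply, Matrix.mul_apply, MonoidAlgebra.coeff_add, Finsupp.add_apply,
      MonoidAlgebra.coeff_sum, Finsupp.finsetSum_apply, coeff_label_mul_of, coeffMatrix,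
      Matrix.of_apply, Finset.sum_add_distrib]
    classical
    have h0 : ((1 : Matrix (Fin A.size) (Fin A.size) (NCPoly F X)) u v).coeff
        (FreeMonoid.of x * w) = 0 := by
      rcases eq_or_ne u v with rfl | huv
      · rw [Matrix.one_apply_eq, MonoidAlgebra.one_def, MonoidAlgebra.coeff_single,
          Finsupp.single_apply, if_neg]
        intro e
        simpa using congrArg FreeMonoid.toList e
      · simp [Matrix.one_apply_ne huv]
    rw [h0, zero_add]
  have h2 := mul_eq_one_comm.1 A.one_sub_cst_mul_coeffMatrix_one
  calc A.coeffMatrix (FreeMonoid.of x * w)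
      = A.coeffMatrix 1 * ((1 - Matrix.of A.cst) * A.coeffMatrix (FreeMonoid.of x * w)) := by
        rw [← mul_assoc, h2, one_mul]
    _ = _ := by
        rw [mul_assoc, sub_mul, one_mul]
        congr 1
        rw [sub_eq_iff_eq_add']
        exact h

/-- The transfer matrix of a word. -/
noncomputable def transfer [Fintype X] (A : ABP F X) (l : List X) :
    Matrix (Fin A.size) (Fin A.size) F :=
  (l.map fun x => A.coeffMatrix 1 * Matrix.of fun u v => A.lin u v x).prod

theorem coeffMatrix_mul [Fintype X] (A : ABP F X) (l : List X) (w : FreeMonoid X) :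
    A.coeffMatrix (FreeMonoid.ofList l * w) = A.transfer l * A.coeffMatrix w := by
  induction l with
  | nil => simp [transfer]
  | cons x l ih =>
    rw [FreeMonoid.ofList_cons, mul_assoc, coeffMatrix_of_mul, ih]
    simp [transfer, mul_assoc]

/-- The identity matrix on `ι` factors through the vertices reachable by the prefixes, so its rank
is at most their number. Taking `S` to be all vertices bounds the size, a single layer the width. -/
theorem card_le_of_transfer [Fintype X] (A : ABP F X) {ι : Type*} [Fintype ι] [DecidableEq ι]
    (a b : ι → List X)
    (h : ∀ i j, A.poly.coeff (FreeMonoid.ofList (a i) * FreeMonoid.ofList (b j)) =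
      if i = j then 1 else 0)
    (S : Finset (Fin A.size)) (hS : ∀ i p, A.transfer (a i) A.source p ≠ 0 → p ∈ S) :
    Fintype.card ι ≤ S.card := by
  let P : Matrix ι S F := Matrix.of fun i p => A.transfer (a i) A.source p
  let Q : Matrix S ι F := Matrix.of fun p j => A.coeffMatrix (FreeMonoid.ofList (b j)) p A.sink
  have hPQ : P * Q = 1 := by
    ext i j
    rw [Matrix.one_apply, ← h i j, poly_eq_pathSum]
    have := congrFun (congrFun (A.coeffMatrix_mul (a i) (FreeMonoid.ofList (b j))) A.source) A.sink
    rw [coeffMatrix, Matrix.of_apply] at this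
    rw [this, Matrix.mul_apply, Matrix.mul_apply]
    simp only [P, Q, Matrix.of_apply]
    rw [Finset.sum_coe_sort S
      (fun p => A.transfer (a i) A.source p * A.coeffMatrix (FreeMonoid.ofList (b j)) p A.sink)]
    refine Finset.sum_subset (Finset.subset_univ S) fun p _ hp => ?_
    have : A.transfer (a i) A.source p = 0 := by
      by_contra h0
      exact hp (hS i p h0)
    rw [this, zero_mul]
  have h1 : (P * Q).rank ≤ P.rank := Matrix.rank_mul_le_left P Q
  rw [hPQ, Matrix.rank_one] at h1
  have h2 := Matrix.rank_le_card_width P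
  simpa using h1.trans h2

theorem card_le_size [Fintype X] (A : ABP F X) {ι : Type*} [Fintype ι] [DecidableEq ι]
    (a b : ι → List X)
    (h : ∀ i j, A.poly.coeff (FreeMonoid.ofList (a i) * FreeMonoid.ofList (b j)) =
      if i = j then 1 else 0) :
    Fintype.card ι ≤ A.size := by
  simpa using A.card_le_of_transfer a b h Finset.univ (by simp)

theorem Layering.layer_of_transfer_ne_zero [Fintype X] {A : ABP F X} (L : A.Layering) (l : List X)
    {u v : Fin A.size} (h : A.transfer l u v ≠ 0) : L.layer v = L.layer u + l.length := by
  -- Without constant labels only the trivial path spells the empty word, so each letter advances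
  -- exactly one layer.
  have hone : A.coeffMatrix 1 = 1 := by
    have := A.one_sub_cst_mul_coeffMatrix_one
    have h0 : Matrix.of A.cst = 0 := by
      ext u v
      exact L.cst_eq_zero u v
    simpa [h0] using this
  induction l generalizing u with
  | nil =>
    rcases eq_or_ne u v with rfl | huv
    · simp
    · exact absurd (by simp [transfer, Matrix.one_apply_ne huv]) h
  | cons x l ih =>
    have hc : A.transfer (x :: l) = Matrix.of (fun u v => A.lin u v x) * A.transfer l := by
      simp [transfer, hone]
    rw [hc, Matrix.mul_apply] at h
    obtain ⟨p, -, hp⟩ := Finset.exists_ne_zero_of_sum_ne_zero h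
    have h1 := ih (right_ne_zero_of_mul hp)
    have h2 := L.layer_succ u p (fun e => left_ne_zero_of_mul hp (by simp [e]))
    rw [h1, h2, List.length_cons]
    ring

theorem Layering.card_le_width [Fintype X] {A : ABP F X} (L : A.Layering) {ι : Type*} [Fintype ι]
    [DecidableEq ι] (a b : ι → List X) (k : ℕ) (hk : ∀ i, (a i).length = k)
    (h : ∀ i j, A.poly.coeff (FreeMonoid.ofList (a i) * FreeMonoid.ofList (b j)) =
      if i = j then 1 else 0) :
    Fintype.card ι ≤ L.width := by
  have h1 := A.card_le_of_transfer a b h (Finset.univ.filter fun u => L.layer u = k) (by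
    intro i p hp
    simp [L.layer_of_transfer_ne_zero (a i) hp, hk, L.layer_source])
  rcases (Finset.univ.filter fun u => L.layer u = k).eq_empty_or_nonempty with he | ⟨v, hv⟩
  · rw [he] at h1
    exact h1.trans (by simp)
  · refine h1.trans ?_
    have hv' : L.layer v = k := by simpa using hv
    rw [← hv']
    exact Finset.le_sup (f := fun v => (Finset.univ.filter fun u => L.layer u = L.layer v).card)
      (Finset.mem_univ v)

end ABP

/-! ### Cut triples in the complete binary tree -/

namespace Node

/-- The inner node of the tree of depth `d + 1` in the same place as a node of the tree of
depth `d`. -/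
def apex : {d : ℕ} → Node d → Node (d + 1)
  | _, root => root
  | _, left v => left (apex v)
  | _, right v => right (apex v)

/-- The left child of an inner node. -/
def leftChild : {d : ℕ} → Node d → Node (d + 1)
  | _, root => left root
  | _, left v => left (leftChild v)
  | _, right v => right (leftChild v)

/-- The right child of an inner node. -/
def rightChild : {d : ℕ} → Node d → Node (d + 1)
  | _, root => right root
  | _, left v => left (rightChild v)
  | _, right v => right (rightChild v)

theorem apex_injective {d : ℕ} : Function.Injective (apex (d := d)) := by
  intro p q h
  induction p with
  | root => cases q <;> simp_all [apex]
  | left v ih => cases q with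
    | root => simp [apex] at h
    | left w => rw [ih (by simpa [apex] using h)]
    | right w => simp [apex] at h
  | right v ih => cases q with
    | root => simp [apex] at h
    | left w => simp [apex] at h
    | right w => rw [ih (by simpa [apex] using h)]

theorem leftChild_injective {d : ℕ} : Function.Injective (leftChild (d := d)) := by
  intro p q h
  induction p with
  | root => cases q with
    | root => rfl
    | left v => cases v <;> simp [leftChild] at h
    | right v => simp [leftChild] at h
  | left v ih => cases q with
    | root => cases v <;> simp [leftChild] at h
    | left w => rw [ih (by simpa [leftChild] using h)]
    | right w => simp [leftChild] at h
  | right v ih => cases q with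
    | root => simp [leftChild] at h
    | left w => simp [leftChild] at h
    | right w => rw [ih (by simpa [leftChild] using h)]

theorem rightChild_injective {d : ℕ} : Function.Injective (rightChild (d := d)) := by
  intro p q h
  induction p with
  | root => cases q with
    | root => rfl
    | left v => simp [rightChild] at h
    | right v => cases v <;> simp [rightChild] at h
  | left v ih => cases q with
    | root => simp [rightChild] at h
    | left w => rw [ih (by simpa [rightChild] using h)]
    | right w => simp [rightChild] at h
  | right v ih => cases q with
    | root => cases v <;> simp [rightChild] at h
    | left w => simp [rightChild] at h
    | right w => rw [ih (by simpa [rightChild] using h)]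

/-- Whether a node is a left child; the root counts as `c`. -/
def side : {d : ℕ} → Bool → Node d → Bool
  | _, c, root => c
  | _, _, left v => side true v
  | _, _, right v => side false v

theorem side_leftChild {d : ℕ} (c : Bool) (p : Node d) : side c p.leftChild = true := by
  induction p generalizing c with
  | root => rfl
  | left v ih => exact ih _
  | right v ih => exact ih _

theorem side_rightChild {d : ℕ} (c : Bool) (p : Node d) : side c p.rightChild = false := by
  induction p generalizing c with
  | root => rfl
  | left v ih => exact ih _
  | right v ih => exact ih _

/-- The nodes of a tree of depth `d + 1` are its root and the nodes of its two subtrees. -/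
def equivSucc (d : ℕ) : Node (d + 1) ≃ Option (Node d ⊕ Node d) where
  toFun
    | root => none
    | left v => some (Sum.inl v)
    | right v => some (Sum.inr v)
  invFun
    | none => root
    | some (Sum.inl v) => left v
    | some (Sum.inr v) => right v
  left_inv v := by cases v <;> rfl
  right_inv v := by rcases v with _ | _ | _ <;> rfl

theorem sum_succ {M : Type*} [AddCommMonoid M] {d : ℕ} (f : Node (d + 1) → M) :
    ∑ v, f v = f root + (∑ v : Node d, f (left v) + ∑ v : Node d, f (right v)) := by
  rw [← (equivSucc d).symm.sum_comp, Fintype.sum_option, Fintype.sum_sum_type]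
  rfl

theorem sum_zero {M : Type*} [AddCommMonoid M] (f : Node 0 → M) : ∑ v, f v = f root := by
  refine Fintype.sum_eq_single root fun v hv => ?_
  cases v
  exact absurd rfl hv

/-- The triple formed by an inner node and its children meets both `S` and its complement. -/
def IsCut {d : ℕ} (S : Node (d + 1) → Bool) (p : Node d) : Prop :=
  ¬ (S p.apex = S p.leftChild ∧ S p.apex = S p.rightChild)

instance {d : ℕ} (S : Node (d + 1) → Bool) : DecidablePred (IsCut S) :=
  fun _ => inferInstanceAs (Decidable (¬ _))

/-- The number of triples cut by `S`. -/
def cutCount {d : ℕ} (S : Node (d + 1) → Bool) : ℕ := ∑ p, if IsCut S p then 1 else 0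

theorem cutCount_eq_card {d : ℕ} (S : Node (d + 1) → Bool) :
    cutCount S = (Finset.univ.filter (IsCut S)).card := by
  simp [cutCount]

theorem cutCount_succ {d : ℕ} (S : Node (d + 2) → Bool) :
    cutCount S = (if IsCut S root then 1 else 0) +
      (cutCount (fun v => S (left v)) + cutCount (fun v => S (right v))) := by
  rw [cutCount, sum_succ]
  rfl

/-- The triples connect the tree, so a set that cuts none of them is empty or everything. -/
theorem eq_root_of_cutCount_eq_zero {d : ℕ} (S : Node (d + 1) → Bool) (h : cutCount S = 0)
    (v : Node (d + 1)) : S v = S root := by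
  induction d with
  | zero =>
    rw [cutCount, sum_zero] at h
    have h1 : ¬ IsCut S root := by
      intro hc
      rw [if_pos hc] at h
      omega
    simp only [IsCut, apex, leftChild, rightChild, not_not] at h1
    rcases v with _ | ⟨⟨⟩⟩ | ⟨⟨⟩⟩
    · rfl
    · exact h1.1.symm
    · exact h1.2.symm
  | succ d ih =>
    rw [cutCount_succ] at h
    have h1 : ¬ IsCut S root := by
      intro hc
      rw [if_pos hc] at h
      omega
    simp only [IsCut, apex, leftChild, rightChild, not_not] at h1
    rcases v with _ | v | v
    · rfl
    · exact (ih (fun v => S (left v)) (by omega) v).trans h1.1.symm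
    · exact (ih (fun v => S (right v)) (by omega) v).trans h1.2.symm

/-- If a set cuts at least `n` triples of one of the subtrees at the first three grandchildren of
the root, and separates a node of the second from a node of the third, then it cuts at least
`n + 1` triples. -/
theorem cutCount_add_two {d n : ℕ} (S : Node (d + 3) → Bool)
    (h : (n ≤ cutCount (fun v => S (left (left v))) ∧
        ∃ u v, S (left (right u)) ≠ S (right (left v))) ∨
      (n ≤ cutCount (fun v => S (left (right v))) ∧
        ∃ u v, S (left (left u)) ≠ S (right (left v))) ∨
      (n ≤ cutCount (fun v => S (right (left v))) ∧
        ∃ u v, S (left (left u)) ≠ S (left (right v)))) :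
    n + 1 ≤ cutCount S := by
  by_contra hlt
  simp only [cutCount_succ] at hlt
  have key : ∀ (T : Node (d + 1) → Bool), cutCount T = 0 → ∀ v, T v = T root :=
    eq_root_of_cutCount_eq_zero
  have kLL := key fun v => S (left (left v))
  have kLR := key fun v => S (left (right v))
  have kRL := key fun v => S (right (left v))
  have i0 : (if IsCut S root then 1 else 0) = 0 →
      S root = S (left root) ∧ S root = S (right root) := by
    simp [IsCut, apex, leftChild, rightChild]
  have iL : (if IsCut (fun v => S (left v)) root then 1 else 0) = 0 →
      S (left root) = S (left (left root)) ∧ S (left root) = S (left (right root)) := by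
    simp [IsCut, apex, leftChild, rightChild]
  have iR : (if IsCut (fun v => S (right v)) root then 1 else 0) = 0 →
      S (right root) = S (right (left root)) ∧ S (right root) = S (right (right root)) := by
    simp [IsCut, apex, leftChild, rightChild]
  -- One subtree already accounts for all the cuts, so the triples joining the other two, and those
  -- inside them, are uncut; following them from `u` to `v` contradicts `huv`.
  rcases h with ⟨h1, u, v, huv⟩ | ⟨h1, u, v, huv⟩ | ⟨h1, u, v, huv⟩
  · obtain ⟨a1, a2⟩ := i0 (by omega)
    obtain ⟨b1, b2⟩ := iL (by omega)
    obtain ⟨c1, c2⟩ := iR (by omega)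
    have e1 := kLR (by omega) u
    have e2 := kRL (by omega) v
    exact huv (e1.trans (b2.symm.trans (a1.symm.trans (a2.trans (c1.trans e2.symm)))))
  · obtain ⟨a1, a2⟩ := i0 (by omega)
    obtain ⟨b1, b2⟩ := iL (by omega)
    obtain ⟨c1, c2⟩ := iR (by omega)
    have e1 := kLL (by omega) u
    have e2 := kRL (by omega) v
    exact huv (e1.trans (b1.symm.trans (a1.symm.trans (a2.trans (c1.trans e2.symm)))))
  · obtain ⟨b1, b2⟩ := iL (by omega)
    have e1 := kLL (by omega) u
    have e2 := kLR (by omega) v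
    exact huv (e1.trans (b1.symm.trans (b2.trans e2.symm)))

theorem exists_ne_of_cutCount_pos {d : ℕ} (S : Node (d + 1) → Bool) (h : 0 < cutCount S) :
    (∃ v, S v = true) ∧ ∃ v, S v = false := by
  constructor
  · by_contra! hn
    refine h.ne' (Finset.sum_eq_zero fun p _ => if_neg ?_)
    simp [IsCut, hn]
  · by_contra! hn
    refine h.ne' (Finset.sum_eq_zero fun p _ => if_neg ?_)
    simp [IsCut, hn]

/-- In every linear arrangement of the nodes of the tree of depth `d + 1` some initial segment
cuts at least `(d + 2) / 2` triples. -/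
theorem exists_le_cutCount : ∀ (d : ℕ) (r : Node (d + 1) → ℕ), Function.Injective r →
    ∃ k, (d + 2) / 2 ≤ cutCount fun v => decide (r v < k)
  | d + 2, r, hr => by
    obtain ⟨k₁, h₁⟩ := exists_le_cutCount d (fun v => r (left (left v)))
      fun a b h => by simpa using hr h
    obtain ⟨k₂, h₂⟩ := exists_le_cutCount d (fun v => r (left (right v)))
      fun a b h => by simpa using hr h
    obtain ⟨k₃, h₃⟩ := exists_le_cutCount d (fun v => r (right (left v)))
      fun a b h => by simpa using hr h
    -- Each threshold splits its own subtree: `x` comes before it and `y` does not.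
    obtain ⟨⟨x₁, hx₁⟩, y₁, hy₁⟩ := exists_ne_of_cutCount_pos _ (lt_of_lt_of_le (by omega) h₁)
    obtain ⟨⟨x₂, hx₂⟩, y₂, hy₂⟩ := exists_ne_of_cutCount_pos _ (lt_of_lt_of_le (by omega) h₂)
    obtain ⟨⟨x₃, hx₃⟩, y₃, hy₃⟩ := exists_ne_of_cutCount_pos _ (lt_of_lt_of_le (by omega) h₃)
    simp only [decide_eq_true_eq, decide_eq_false_iff_not, not_lt] at hx₁ hx₂ hx₃ hy₁ hy₂ hy₃
    have hd : (d + 2 + 2) / 2 = (d + 2) / 2 + 1 := by omega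
    rw [hd]
    have key : ∀ {a b k : ℕ}, a < k → k ≤ b → decide (a < k) ≠ decide (b < k) := by
      intro a b k ha hb
      simp [ha, hb]
    have key' : ∀ {a b k : ℕ}, a < k → k ≤ b → decide (b < k) ≠ decide (a < k) := by
      intro a b k ha hb
      simp [ha, hb]
    -- The median threshold keeps the cuts in its own subtree. The subtree with the smaller
    -- threshold has a node before it, the one with the larger a node after it, which yields one
    -- more cut.
    have hmid : (k₂ ≤ k₁ ∧ k₁ ≤ k₃ ∨ k₃ ≤ k₁ ∧ k₁ ≤ k₂) ∨ (k₁ ≤ k₂ ∧ k₂ ≤ k₃ ∨ k₃ ≤ k₂ ∧ k₂ ≤ k₁) ∨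
      (k₁ ≤ k₃ ∧ k₃ ≤ k₂ ∨ k₂ ≤ k₃ ∧ k₃ ≤ k₁) := by omega
    rcases hmid with h | h | h
    · refine ⟨k₁, cutCount_add_two _ (Or.inl ⟨h₁, ?_⟩)⟩
      rcases h with h | h
      · exact ⟨x₂, y₃, key (hx₂.trans_le h.1) (h.2.trans hy₃)⟩
      · exact ⟨y₂, x₃, key' (hx₃.trans_le h.1) (h.2.trans hy₂)⟩
    · refine ⟨k₂, cutCount_add_two _ (Or.inr (Or.inl ⟨h₂, ?_⟩))⟩
      rcases h with h | h
      · exact ⟨x₁, y₃, key (hx₁.trans_le h.1) (h.2.trans hy₃)⟩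
      · exact ⟨y₁, x₃, key' (hx₃.trans_le h.1) (h.2.trans hy₁)⟩
    · refine ⟨k₃, cutCount_add_two _ (Or.inr (Or.inr ⟨h₃, ?_⟩))⟩
      rcases h with h | h
      · exact ⟨x₁, y₂, key (hx₁.trans_le h.1) (h.2.trans hy₂)⟩
      · exact ⟨y₁, x₂, key' (hx₂.trans_le h.1) (h.2.trans hy₁)⟩
  | 0, r, hr => by
    obtain ⟨k, hk⟩ := exists_cutCount_pos r hr
    exact ⟨k, hk⟩
  | 1, r, hr => by
    obtain ⟨k, hk⟩ := exists_cutCount_pos r hr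
    exact ⟨k, hk⟩
where
  exists_cutCount_pos {d : ℕ} (r : Node (d + 1) → ℕ) (hr : Function.Injective r) :
      ∃ k, 0 < cutCount fun v => decide (r v < k) := by
    have hne : r root ≠ r (left root) := fun e => by simpa using hr e
    refine ⟨max (r root) (r (left root)), Nat.pos_of_ne_zero fun h0 => ?_⟩
    have := eq_root_of_cutCount_eq_zero _ h0 (left root)
    simp only [decide_eq_decide] at this
    omega

/-! ### Legal colourings with prescribed values -/

theorem isLegal_succ_iff {m : ℕ} : ∀ {d : ℕ} (γ : Node (d + 1) → ZMod m),
    IsLegal (d + 1) γ ↔ ∀ p : Node d, γ p.apex = γ p.leftChild + γ p.rightChild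
  | 0, γ => by
    simp only [IsLegal, and_true]
    constructor
    · rintro h ⟨⟩
      exact h
    · exact fun h => h root
  | d + 1, γ => by
    rw [IsLegal, isLegal_succ_iff, isLegal_succ_iff]
    constructor
    · rintro ⟨h0, h1, h2⟩ (_ | p | p)
      · exact h0
      · exact h1 p
      · exact h2 p
    · exact fun h => ⟨h root, fun p => h (left p), fun p => h (right p)⟩

/-- The legal colouring with root colour `a` that takes the values `f` at the children on side
`b`. -/
def extend {m : ℕ} (b : Bool) : {d : ℕ} → ZMod m → (Node d → ZMod m) → Node d → ZMod m
  | _, a, _, root => a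
  | _, a, f, left v =>
    extend b (if b then f (left root) else a - f (right root)) (fun w => f (left w)) v
  | _, a, f, right v =>
    extend b (if b then a - f (left root) else f (right root)) (fun w => f (right w)) v

theorem extend_root {m : ℕ} (b : Bool) {d : ℕ} (a : ZMod m) (f : Node d → ZMod m) :
    extend b a f root = a := by
  cases d <;> rfl

theorem isLegal_extend {m : ℕ} (b : Bool) : ∀ {d : ℕ} (a : ZMod m) (f : Node d → ZMod m),
    IsLegal d (extend b a f)
  | 0, _, _ => trivial
  | d + 1, a, f => by
    refine ⟨?_, isLegal_extend b _ _, isLegal_extend b _ _⟩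
    simp only [extend]
    cases b <;> simp

/-- Only one child of each inner node is prescribed, so its sibling absorbs the equation. The root
has no sibling; `ha` covers the case where it counts as prescribed. -/
theorem extend_of_side {m : ℕ} (b : Bool) {d : ℕ} (c : Bool) (a : ZMod m) (f : Node d → ZMod m)
    (ha : c = b → a = f root) (v : Node d) (hv : side c v = b) : extend b a f v = f v := by
  induction v generalizing c a with
  | root => rw [extend_root]; exact ha hv
  | left v ih =>
    refine ih true _ (fun w => f (left w)) ?_ hv
    rintro rfl
    rfl
  | right v ih =>
    refine ih false _ (fun w => f (right w)) ?_ hv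
    rintro rfl
    rfl

/-- The colouring that agrees with `γ` on `S` and with `δ` elsewhere. -/
def mix {α β : Type*} (S : α → Bool) (γ δ : α → β) (v : α) : β := if S v then γ v else δ v

/-- The node `x` is separated by `S` from the other two nodes of the triple of `p`. -/
def IsLone {d : ℕ} (S : Node (d + 1) → Bool) (p : Node d) (x : Node (d + 1)) : Prop :=
  (x = p.apex ∧ S p.leftChild = !S x ∧ S p.rightChild = !S x) ∨
  (x = p.leftChild ∧ S p.apex = !S x ∧ S p.rightChild = !S x) ∨
  (x = p.rightChild ∧ S p.apex = !S x ∧ S p.leftChild = !S x)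

/-- In the mixture `x` is coloured by one colouring and the other two nodes by the other; two
colours of a triple determine the third. -/
theorem IsLone.eq_of_isLegal_mix {m d : ℕ} {S : Node (d + 1) → Bool} {p : Node d}
    {x : Node (d + 1)} (hx : IsLone S p x) {γ δ : Node (d + 1) → ZMod m}
    (hγ : IsLegal (d + 1) γ) (hδ : IsLegal (d + 1) δ) (h : IsLegal (d + 1) (mix S γ δ)) :
    γ x = δ x := by
  have h1 := isLegal_succ_iff γ |>.1 hγ p
  have h2 := isLegal_succ_iff δ |>.1 hδ p
  have h3 := isLegal_succ_iff _ |>.1 h p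
  simp only [mix] at h3
  rcases hx with ⟨rfl, ha, hb⟩ | ⟨rfl, ha, hb⟩ | ⟨rfl, ha, hb⟩ <;> rw [ha, hb] at h3
  · cases hS : S p.apex <;> simp [hS] at h3
    · rw [h1, ← h3]
    · rw [h3, h2]
  · cases hS : S p.leftChild <;> simp [hS] at h3
    · exact add_right_cancel (h1.symm.trans h3)
    · exact add_right_cancel (h3.symm.trans h2)
  · cases hS : S p.rightChild <;> simp [hS] at h3
    · exact add_left_cancel (h1.symm.trans h3)
    · exact add_left_cancel (h3.symm.trans h2)

/-- Legal colourings, indexed by the assignments of colours to the nodes in `T`, no two of which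
can be mixed along `S` to a legal colouring. -/
theorem exists_fooling_of_isLone (m : ℕ) {d : ℕ} (S : Node (d + 1) → Bool) (T : Finset (Node d))
    (b : Bool) (n : Node d → Node (d + 1)) (hn : Function.Injective n)
    (hside : ∀ p ∈ T, side true (n p) = b) (hlone : ∀ p ∈ T, IsLone S p (n p)) :
    ∃ γ : (T → ZMod m) → Node (d + 1) → ZMod m, (∀ i, IsLegal (d + 1) (γ i)) ∧
      ∀ i j, IsLegal (d + 1) (mix S (γ i) (γ j)) → i = j := by
  have hinj : Function.Injective fun p : T => n p := hn.comp Subtype.val_injective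
  -- The colour `0` away from the nodes `n p` is arbitrary.
  let f : (T → ZMod m) → Node (d + 1) → ZMod m := fun i =>
    Function.extend (fun p : T => n p) i 0
  refine ⟨fun i => extend b (f i root) (f i), fun i => isLegal_extend _ _ _, fun i j h => ?_⟩
  funext p
  have h1 := (hlone p p.2).eq_of_isLegal_mix (isLegal_extend _ _ _) (isLegal_extend _ _ _) h
  have hv : ∀ i, extend b (f i root) (f i) (n p) = i p := fun i => by
    rw [extend_of_side b true _ _ (fun _ => rfl) _ (hside p p.2)]
    exact hinj.extend_apply i 0 p
  rwa [hv, hv] at h1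

/-- Pigeonhole on the position of the lone node in a cut triple. Lone apexes are split by side,
since a node and its sibling cannot both be prescribed freely. -/
theorem exists_fooling (m : ℕ) {d : ℕ} (S : Node (d + 1) → Bool) :
    ∃ T : Finset (Node d), cutCount S ≤ 4 * T.card ∧
      ∃ γ : (T → ZMod m) → Node (d + 1) → ZMod m, (∀ i, IsLegal (d + 1) (γ i)) ∧
        ∀ i j, IsLegal (d + 1) (mix S (γ i) (γ j)) → i = j := by
  let T₁ := Finset.univ.filter fun p : Node d => side true p.apex = true ∧
    S p.leftChild = !S p.apex ∧ S p.rightChild = !S p.apex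
  let T₂ := Finset.univ.filter fun p : Node d => side true p.apex = false ∧
    S p.leftChild = !S p.apex ∧ S p.rightChild = !S p.apex
  let T₃ := Finset.univ.filter fun p : Node d =>
    S p.apex = !S p.leftChild ∧ S p.rightChild = !S p.leftChild
  let T₄ := Finset.univ.filter fun p : Node d =>
    S p.apex = !S p.rightChild ∧ S p.leftChild = !S p.rightChild
  have hsub : Finset.univ.filter (IsCut S) ⊆ T₁ ∪ T₂ ∪ T₃ ∪ T₄ := by
    intro p hp
    simp only [Finset.mem_filter, Finset.mem_univ, true_and, IsCut] at hp
    simp only [T₁, T₂, T₃, T₄, Finset.mem_union, Finset.mem_filter, Finset.mem_univ, true_and]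
    revert hp
    generalize S p.apex = a
    generalize S p.leftChild = b
    generalize S p.rightChild = c
    generalize side true p.apex = s
    revert a b c s
    decide
  have hcard : cutCount S ≤ T₁.card + T₂.card + T₃.card + T₄.card := by
    rw [cutCount_eq_card]
    refine (Finset.card_le_card hsub).trans ((Finset.card_union_le _ _).trans ?_)
    gcongr
    refine (Finset.card_union_le _ _).trans ?_
    gcongr
    exact Finset.card_union_le _ _
  have hmax : cutCount S ≤ 4 * T₁.card ∨ cutCount S ≤ 4 * T₂.card ∨ cutCount S ≤ 4 * T₃.card ∨
      cutCount S ≤ 4 * T₄.card := by omega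
  rcases hmax with h | h | h | h
  · exact ⟨T₁, h, exists_fooling_of_isLone m S T₁ true apex apex_injective
      (fun p hp => (Finset.mem_filter.1 hp).2.1)
      fun p hp => Or.inl ⟨rfl, (Finset.mem_filter.1 hp).2.2⟩⟩
  · exact ⟨T₂, h, exists_fooling_of_isLone m S T₂ false apex apex_injective
      (fun p hp => (Finset.mem_filter.1 hp).2.1)
      fun p hp => Or.inl ⟨rfl, (Finset.mem_filter.1 hp).2.2⟩⟩
  · exact ⟨T₃, h, exists_fooling_of_isLone m S T₃ true leftChild leftChild_injective
      (fun p _ => side_leftChild _ p)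
      fun p hp => Or.inr (Or.inl ⟨rfl, (Finset.mem_filter.1 hp).2⟩)⟩
  · exact ⟨T₄, h, exists_fooling_of_isLone m S T₄ false rightChild rightChild_injective
      (fun p _ => side_rightChild _ p)
      fun p hp => Or.inr (Or.inr ⟨rfl, (Finset.mem_filter.1 hp).2⟩)⟩

end Node

/-! ### The coefficients of the shuffled tree polynomial -/

theorem length_inorder : ∀ d : ℕ, (inorder d).length = 2 ^ (d + 1) - 1
  | 0 => rfl
  | d + 1 => by
    have := Nat.one_le_two_pow (n := d + 1)
    rw [inorder, List.length_append, List.length_cons, List.length_map, List.length_map,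
      length_inorder d, pow_succ _ (d + 1)]
    omega

theorem nodup_inorder : ∀ d : ℕ, (inorder d).Nodup
  | 0 => List.nodup_singleton _
  | d + 1 => by
    have h := nodup_inorder d
    rw [inorder, List.nodup_append', List.nodup_cons]
    refine ⟨h.map fun a b e => by simpa using e, ⟨by simp, h.map fun a b e => by simpa using e⟩, ?_⟩
    simp [List.disjoint_left]

/-- The nodes in the order in which `Δ_σ` lists their colours. -/
def arrangement {d : ℕ} (σ : Equiv.Perm (Fin (2 ^ (d + 1) - 1))) :
    Fin (2 ^ (d + 1) - 1) ≃ Node d :=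
  σ.trans ((finCongr (length_inorder d).symm).trans
    ((nodup_inorder d).getEquivOfForallMemList (inorder d) mem_inorder))

/-- The word of a colouring, permuted by `σ`. -/
def shuffledWord {X : Type*} {d : ℕ} (σ : Equiv.Perm (Fin (2 ^ (d + 1) - 1))) (γ : Node d → X) :
    List X :=
  List.ofFn fun i => γ (arrangement σ i)

theorem shuffledWord_injective {X : Type*} {d : ℕ} (σ : Equiv.Perm (Fin (2 ^ (d + 1) - 1))) :
    Function.Injective (shuffledWord (X := X) σ) := by
  intro γ δ h
  have h1 := List.ofFn_injective h
  funext v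
  simpa using congrFun h1 ((arrangement σ).symm v)

theorem shuffleWord_inorder {X : Type*} {d : ℕ} (σ : Equiv.Perm (Fin (2 ^ (d + 1) - 1)))
    (γ : Node d → X) :
    shuffleWord σ (FreeMonoid.ofList ((inorder d).map γ)) =
      FreeMonoid.ofList (shuffledWord σ γ) := by
  have h : (FreeMonoid.ofList ((inorder d).map γ)).toList.length = 2 ^ (d + 1) - 1 := by
    simp [length_inorder]
  rw [shuffleWord, dif_pos h]
  congr 1
  refine List.ofFn_inj.2 (funext fun i => ?_)
  simp [arrangement]
  rfl

theorem shuffle_sum {F : Type*} [Field F] {X ι : Type*} {n : ℕ} (σ : Equiv.Perm (Fin n))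
    (s : Finset ι) (f : ι → NCPoly F X) : shuffle σ (∑ i ∈ s, f i) = ∑ i ∈ s, shuffle σ (f i) := by
  classical
  induction s using Finset.induction_on with
  | empty => simp [shuffle]
  | insert a s ha ih =>
    rw [Finset.sum_insert ha, Finset.sum_insert ha, ← ih]
    exact MonoidAlgebra.mapDomain_add ..

open Classical in
theorem coeff_shuffle_treePoly (F : Type*) [Field F] (m : ℕ) [NeZero m] {d : ℕ}
    (σ : Equiv.Perm (Fin (2 ^ (d + 1) - 1))) (γ : Node d → ZMod m) :
    (shuffle σ (treePoly F m d)).coeff (FreeMonoid.ofList (shuffledWord σ γ)) =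
      if IsLegal d γ then 1 else 0 := by
  rw [treePoly, shuffle_sum, MonoidAlgebra.coeff_sum, Finsupp.finsetSum_apply]
  have h : ∀ δ : Node d → ZMod m, (shuffle σ (MonoidAlgebra.single (FreeMonoid.ofList
      ((inorder d).map δ)) (1 : F))).coeff (FreeMonoid.ofList (shuffledWord σ γ)) =
      if γ = δ then 1 else 0 := by
    intro δ
    rw [shuffle, MonoidAlgebra.mapDomain_single, shuffleWord_inorder,
      MonoidAlgebra.coeff_single, Finsupp.single_apply]
    refine if_congr ?_ rfl rfl
    rw [FreeMonoid.ofList.injective.eq_iff, (shuffledWord_injective σ).eq_iff, eq_comm]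
  simp only [h]
  rw [Finset.sum_ite_eq]
  simp

theorem treePoly_ne_zero (F : Type*) [Field F] (m : ℕ) [NeZero m] (d : ℕ) :
    treePoly F m d ≠ 0 := by
  intro h
  have hl : ∀ d : ℕ, IsLegal d (0 : Node d → ZMod m) := by
    intro d
    cases d with
    | zero => trivial
    | succ d => exact (Node.isLegal_succ_iff _).2 fun p => by simp
  have := coeff_shuffle_treePoly F m (Equiv.refl (Fin (2 ^ (d + 1) - 1))) 0
  rw [h, if_pos (hl d), shuffle, MonoidAlgebra.mapDomain_zero] at this
  simp at this

theorem isHomogeneous_treePoly (F : Type*) [Field F] (m : ℕ) [NeZero m] (d : ℕ) :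
    IsHomogeneous (treePoly F m d) (2 ^ (d + 1) - 1) := by
  classical
  intro w hw
  rw [treePoly, MonoidAlgebra.coeff_sum, Finsupp.finsetSum_apply] at hw
  obtain ⟨γ, -, hγ⟩ := Finset.exists_ne_zero_of_sum_ne_zero hw
  rw [MonoidAlgebra.coeff_single, Finsupp.single_apply] at hγ
  have : FreeMonoid.ofList ((inorder d).map γ) = w := by
    by_contra hn
    exact hγ (if_neg hn)
  rw [← this]
  change ((inorder d).map γ).length = _
  rw [List.length_map, length_inorder]

/-- Translates the entries of Nisan's matrix into legality of mixtures. -/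
theorem take_append_drop_shuffledWord {X : Type*} {d : ℕ}
    (σ : Equiv.Perm (Fin (2 ^ (d + 1) - 1))) (k : ℕ) (γ δ : Node d → X) :
    (shuffledWord σ γ).take k ++ (shuffledWord σ δ).drop k =
      shuffledWord σ (Node.mix (fun v => decide (((arrangement σ).symm v : ℕ) < k)) γ δ) := by
  refine List.ext_getElem (by simp [shuffledWord]; omega) fun i h1 h2 => ?_
  rw [List.getElem_append]
  split_ifs with h
  · have hk : i < k := by simp at h; omega
    simp [shuffledWord, Node.mix, hk]
  · have hk : ¬ i < k := by simp [shuffledWord] at h h2; omega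
    have hlen : ((shuffledWord σ γ).take k).length = k := by
      simp [shuffledWord] at h h2 ⊢; omega
    simp only [hlen, List.getElem_drop]
    have : k + (i - k) = i := by omega
    simp [shuffledWord, Node.mix, hk, this]

/-! ### The lower bound for branching programs -/

theorem exists_le_abp (F : Type*) [Field F] (m : ℕ) [NeZero m] {d : ℕ}
    (σ : Equiv.Perm (Fin (2 ^ (d + 1 + 1) - 1))) :
    ∃ t : ℕ, d + 1 ≤ 8 * t ∧ ∀ A : ABP F (ZMod m), A.poly = shuffle σ (treePoly F m (d + 1)) →
      m ^ t ≤ A.size ∧ ∀ L : A.Layering, m ^ t ≤ L.width := by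
  classical
  obtain ⟨k, hk⟩ := Node.exists_le_cutCount d (fun v => ((arrangement σ).symm v : ℕ))
    (Fin.val_injective.comp (arrangement σ).symm.injective)
  obtain ⟨T, hT, γ, hγ, hmix⟩ := Node.exists_fooling m
    fun v => decide (((arrangement σ).symm v : ℕ) < k)
  -- From `(d + 2) / 2 ≤ cutCount ≤ 4 * T.card`, where `2 * ((d + 2) / 2) ≥ d + 1`.
  refine ⟨T.card, by omega, fun A hA => ?_⟩
  have hcoeff : ∀ i j, A.poly.coeff (FreeMonoid.ofList ((shuffledWord σ (γ i)).take k) *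
      FreeMonoid.ofList ((shuffledWord σ (γ j)).drop k)) = if i = j then 1 else 0 := by
    intro i j
    rw [hA, ← FreeMonoid.ofList_append, take_append_drop_shuffledWord, coeff_shuffle_treePoly]
    refine if_congr ⟨hmix i j, ?_⟩ rfl rfl
    rintro rfl
    convert hγ i using 1
    funext v
    simp [Node.mix]
  have hcard : Fintype.card (T → ZMod m) = m ^ T.card := by simp [ZMod.card]
  rw [← hcard]
  exact ⟨A.card_le_size _ _ hcoeff, fun L => L.card_le_width _ _
    -- The threshold `k` may exceed the length of the word.
    (min k (2 ^ (d + 1 + 1) - 1)) (fun i => by simp [shuffledWord]) hcoeff⟩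


/-! ### Parse trees and widths of circuits -/

namespace Circuit

variable {F X : Type*} {C : Circuit F X}

theorem IsParseTree.eq_of_gate_var {g : Fin C.numGates} {x : X} (hg : C.gate g = Gate.var x)
    {t : LTree (Fin C.numGates)} (ht : C.IsParseTree g t) : t = LTree.node g [] := by
  cases ht <;> simp_all

theorem IsParseTree.exists_of_gate_add {g : Fin C.numGates} {l : List (Fin C.numGates)}
    (hg : C.gate g = Gate.add l) {t : LTree (Fin C.numGates)} (ht : C.IsParseTree g t) :
    ∃ h ∈ l, ∃ t', C.IsParseTree h t' ∧ t = LTree.node g [t'] := by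
  cases ht with
  | var _ x h => simp [hg] at h
  | const _ a h => simp [hg] at h
  | add _ l' hg' h hh t' ht' =>
    rw [hg, Gate.add.injEq] at hg'
    exact ⟨h, hg' ▸ hh, t', ht', rfl⟩
  | mul _ l' h => simp [hg] at h

theorem IsParseTree.exists_of_gate_mul {g : Fin C.numGates} {l : List (Fin C.numGates)}
    (hg : C.gate g = Gate.mul l) {t : LTree (Fin C.numGates)} (ht : C.IsParseTree g t) :
    ∃ ts, List.Forall₂ C.IsParseTree l ts ∧ t = LTree.node g ts := by
  cases ht with
  | var _ x h => simp [hg] at h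
  | const _ a h => simp [hg] at h
  | add _ l' h => simp [hg] at h
  | mul _ l' hg' ts hts =>
    rw [hg, Gate.mul.injEq] at hg'
    exact ⟨ts, hg' ▸ hts, rfl⟩

theorem sameShape_node {g g' : Fin C.numGates} {ts ts' : List (LTree (Fin C.numGates))}
    (hg : (C.gate g).kind = (C.gate g').kind) (hts : List.Forall₂ C.SameShape ts ts') :
    C.SameShape (LTree.node g ts) (LTree.node g' ts') := by
  rintro (_ | ⟨i, τ⟩)
  · simp [LTree.labelAt, hg]
  · simp only [LTree.labelAt]
    induction hts generalizing i with
    | nil => simp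
    | cons h _ ih =>
      cases i with
      | zero => simpa using h τ
      | succ i => simpa using ih i

theorem preimageWidth_le_numGates (C : Circuit F X) : C.preimageWidth ≤ C.numGates :=
  ciSup_le fun τ => by
    simpa using Set.ncard_le_ncard (Set.subset_univ (C.preimages τ))

end Circuit

/-- A finite type with a rank function can be numbered in an order that respects the rank. -/
theorem exists_equiv_fin_of_rank {G : Type*} [Fintype G] (r : G → ℕ) :
    ∃ e : G ≃ Fin (Fintype.card G), ∀ g h, r g < r h → e g < e h := by
  let e₀ := Fintype.equivFin G
  refine ⟨e₀.trans (Tuple.sort (r ∘ e₀.symm)).symm, fun g h hlt => ?_⟩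
  by_contra hn
  have := Tuple.monotone_sort (r ∘ e₀.symm) (not_lt.1 hn)
  simp at this
  omega

/-! ### The polynomials of the colourings with a given colour of the root -/

open Classical in
/-- The part of `treePoly` coming from the colourings whose root has colour `a`. -/
noncomputable def rootedPoly (F : Type*) [Field F] {m : ℕ} [NeZero m] (d : ℕ) (a : ZMod m) :
    NCPoly F (ZMod m) :=
  ∑ γ : Node d → ZMod m, if IsLegal d γ ∧ γ Node.root = a then
    MonoidAlgebra.single (FreeMonoid.ofList ((inorder d).map γ)) (1 : F) else 0

theorem treePoly_eq_sum_rootedPoly (F : Type*) [Field F] (m : ℕ) [NeZero m] (d : ℕ) :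
    treePoly F m d = ∑ a, rootedPoly F d a := by
  classical
  simp only [treePoly, rootedPoly]
  rw [Finset.sum_comm, Finset.sum_filter]
  refine Finset.sum_congr rfl fun γ _ => ?_
  by_cases h : IsLegal d γ <;> simp [h]

theorem rootedPoly_zero (F : Type*) [Field F] {m : ℕ} [NeZero m] (a : ZMod m) :
    rootedPoly F 0 a = MonoidAlgebra.single (FreeMonoid.of a) 1 := by
  classical
  rw [rootedPoly, Finset.sum_eq_single fun _ => a]
  · simp [IsLegal, inorder]
  · intro γ _ hγ
    refine if_neg fun h => hγ (funext fun v => ?_)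
    cases v
    exact h.2
  · simp

/-- A colouring consists of the colour of the root and the colourings of the two subtrees. -/
def colouringEquiv (d : ℕ) (X : Type*) :
    (Node (d + 1) → X) ≃ X × (Node d → X) × (Node d → X) where
  toFun γ := (γ Node.root, fun v => γ (Node.left v), fun v => γ (Node.right v))
  invFun q := fun
    | Node.root => q.1
    | Node.left v => q.2.1 v
    | Node.right v => q.2.2 v
  left_inv γ := by
    funext v
    cases v <;> rfl
  right_inv q := rfl

theorem rootedPoly_succ (F : Type*) [Field F] {m : ℕ} [NeZero m] (d : ℕ) (a : ZMod m) :
    rootedPoly F (d + 1) a = ∑ b, rootedPoly F d b *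
      (MonoidAlgebra.single (FreeMonoid.of a) 1 * rootedPoly F d (a - b)) := by
  classical
  have hmap : ∀ (a : ZMod m) (γ δ : Node d → ZMod m),
      (inorder (d + 1)).map ((colouringEquiv d _).symm (a, γ, δ)) =
        (inorder d).map γ ++ a :: (inorder d).map δ := by
    intro a γ δ
    simp only [inorder, List.map_append, List.map_map, List.map_cons]
    rfl
  have hlegal : ∀ (a : ZMod m) (γ δ : Node d → ZMod m),
      IsLegal (d + 1) ((colouringEquiv d _).symm (a, γ, δ)) ↔
        a = γ Node.root + δ Node.root ∧ IsLegal d γ ∧ IsLegal d δ := fun _ _ _ => Iff.rfl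
  have hroot : ∀ (a : ZMod m) (γ δ : Node d → ZMod m),
      (colouringEquiv d _).symm (a, γ, δ) Node.root = a := fun _ _ _ => rfl
  rw [rootedPoly, ← (colouringEquiv d (ZMod m)).symm.sum_comp, Fintype.sum_prod_type,
    Finset.sum_eq_single a]
  · simp only [rootedPoly]
    simp_rw [Finset.mul_sum, Finset.sum_mul]
    rw [Fintype.sum_prod_type_right, Finset.sum_comm (s := (Finset.univ : Finset (ZMod m)))]
    refine Finset.sum_congr rfl fun δ _ => ?_
    rw [Finset.sum_comm]
    refine Finset.sum_congr rfl fun γ _ => ?_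
    -- For fixed subtree colourings only `b = γ root` contributes.
    rw [Finset.sum_eq_single (γ Node.root)]
    · simp only [hlegal, hmap, hroot, and_true, FreeMonoid.ofList_append, FreeMonoid.ofList_cons]
      have hiff : δ Node.root = a - γ Node.root ↔ a = γ Node.root + δ Node.root := by
        rw [eq_sub_iff_add_eq', eq_comm]
      simp only [hiff]
      by_cases h1 : IsLegal d γ <;> by_cases h2 : IsLegal d δ <;>
        by_cases h3 : a = γ Node.root + δ Node.root <;> simp [h1, h2, h3]
    · intro b _ hb
      rw [if_neg (fun h => hb h.2.symm), zero_mul]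
    · simp
  · intro b _ hb
    refine Finset.sum_eq_zero fun q _ => if_neg fun h => hb h.2
  · simp

/-! ### The circuit -/

/-- The gates of the circuit for `treePoly`: a leaf for every variable; for every level `h` and
colour `a` a sum gate; for every positive level and every two colours a product gate; and the
output gate. -/
abbrev TreeGate (m d : ℕ) : Type :=
  ZMod m ⊕ (Fin (d + 1) × ZMod m) ⊕ (Fin d × ZMod m × ZMod m) ⊕ Unit

namespace TreeGate

variable {m d : ℕ}

abbrev leaf (a : ZMod m) : TreeGate m d := .inl a
abbrev sum (h : Fin (d + 1)) (a : ZMod m) : TreeGate m d := .inr (.inl (h, a))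
abbrev prod (h : Fin d) (b c : ZMod m) : TreeGate m d := .inr (.inr (.inl (h, b, c)))
abbrev out : TreeGate m d := .inr (.inr (.inr ()))

/-- The height of a gate. -/
def rank : TreeGate m d → ℕ
  | .inl _ => 0
  | .inr (.inl (h, _)) => 2 * h + 1
  | .inr (.inr (.inl (h, _))) => 2 * h + 2
  | .inr (.inr (.inr _)) => 2 * d + 2

/-- The gates, with names given by `e`. -/
noncomputable def gate (F : Type*) [NeZero m] {s : ℕ} (e : TreeGate m d ≃ Fin s) :
    TreeGate m d → Gate F (ZMod m) s
  | .inl a => .var a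
  -- Level `0` gets a sum gate with a single child, so that every level is reached through sum
  -- gates.
  | .inr (.inl (h, a)) => .add (Fin.cases [e (leaf a)]
      (fun h' => (Finset.univ : Finset (ZMod m)).toList.map fun b => e (prod h' b (a - b))) h)
  | .inr (.inr (.inl (h, b, c))) =>
      .mul [e (sum h.castSucc b), e (leaf (b + c)), e (sum h.castSucc c)]
  | .inr (.inr (.inr _)) =>
      .add ((Finset.univ : Finset (ZMod m)).toList.map fun a => e (sum (Fin.last d) a))

theorem card [NeZero m] :
    Fintype.card (TreeGate m d) = m + ((d + 1) * m + (d * (m * m) + 1)) := by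
  simp [ZMod.card]

theorem toList_map_ne_nil [NeZero m] {α : Type*} (f : ZMod m → α) :
    (Finset.univ : Finset (ZMod m)).toList.map f ≠ [] := by
  simp [Finset.univ_eq_empty_iff]

/-- The circuit for `treePoly`. -/
noncomputable def circuit (F : Type*) [NeZero m]
    (e : TreeGate m d ≃ Fin (Fintype.card (TreeGate m d)))
    (he : ∀ g h, rank g < rank h → e g < e h) : Circuit F (ZMod m) where
  numGates := Fintype.card (TreeGate m d)
  gate g := gate F e (e.symm g)
  root := e out
  acyclic g h hh := by
    obtain ⟨g, rfl⟩ := e.surjective g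
    rw [e.symm_apply_apply] at hh
    rcases g with a | ⟨k, a⟩ | ⟨k, b, c⟩ | _
    · simp [gate, Gate.children] at hh
    · induction k using Fin.cases with
      | zero =>
        simp only [gate, Gate.children, Fin.cases_zero, List.mem_singleton] at hh
        subst hh
        exact he _ _ (by simp [rank])
      | succ k =>
        simp only [gate, Gate.children, Fin.cases_succ, List.mem_map] at hh
        obtain ⟨b, -, rfl⟩ := hh
        exact he _ _ (by simp [rank]; omega)
    · simp only [gate, Gate.children, List.mem_cons, List.not_mem_nil, or_false] at hh
      rcases hh with rfl | rfl | rfl <;> exact he _ _ (by simp [rank])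
    · simp only [gate, Gate.children, List.mem_map] at hh
      obtain ⟨b, -, rfl⟩ := hh
      exact he _ _ (by simp [rank])
  add_ne_nil g := by
    obtain ⟨g, rfl⟩ := e.surjective g
    rw [e.symm_apply_apply]
    rcases g with a | ⟨k, a⟩ | ⟨k, b, c⟩ | _
    · simp [gate]
    · induction k using Fin.cases with
      | zero => simp [gate]
      | succ k => simpa only [gate, Fin.cases_succ, ne_eq, Gate.add.injEq] using toList_map_ne_nil _
    · simp [gate]
    · simpa only [gate, ne_eq, Gate.add.injEq] using toList_map_ne_nil _
  mul_ne_nil g := by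
    rcases e.symm g with a | ⟨k, a⟩ | ⟨k, b, c⟩ | _ <;> simp [gate]

theorem exists_circuit_gate (F : Type*) (m d : ℕ) [NeZero m] :
    ∃ (K : Circuit F (ZMod m)) (e : TreeGate m d ≃ Fin K.numGates),
      K.root = e out ∧ ∀ g, K.gate (e g) = gate F e g := by
  obtain ⟨e, he⟩ := exists_equiv_fin_of_rank (rank (m := m) (d := d))
  exact ⟨circuit F e he, e, rfl, fun g => congrArg (gate F e) (e.symm_apply_apply g)⟩

variable {F : Type*} [NeZero m] {K : Circuit F (ZMod m)} {e : TreeGate m d ≃ Fin K.numGates}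

/-- The gates and wires number `5 m² d + m d + 4 m + 1`, and each monomial is at most `m² d`. -/
theorem circuit_size_le (hK : ∀ g, K.gate (e g) = gate F e g)
    (hd : 0 < d) : K.size ≤ 11 * m ^ 2 * d := by
  have hm : 0 < m := Nat.pos_of_ne_zero (NeZero.ne m)
  have hsum : ∑ g, (K.gate g).children.length =
      ∑ g : TreeGate m d, (gate F e g).children.length := by
    rw [← e.sum_comp]
    simp only [hK]
  rw [Circuit.size]
  have hcard : K.numGates = Fintype.card (TreeGate m d) := by
    simpa using (Fintype.card_congr e).symm
  rw [hsum, Fintype.sum_sum_type, Fintype.sum_sum_type, Fintype.sum_sum_type,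
    Fintype.sum_prod_type, Fintype.sum_prod_type, Fin.sum_univ_succ]
  simp only [gate, Gate.children, Fin.cases_zero, Fin.cases_succ, List.length_map,
    Finset.length_toList, Finset.card_univ, ZMod.card, List.length_cons, List.length_nil,
    Finset.sum_const, smul_eq_mul, Fintype.card_fin, Fintype.card_unit, Fintype.card_prod]
  rw [hcard, card]
  have h1 : m * 1 ≤ m * m := Nat.mul_le_mul_left _ hm
  have h2 : m * m * 1 ≤ m * m * d := Nat.mul_le_mul_left _ hd
  have h3 : m * 1 * d ≤ m * m * d := Nat.mul_le_mul_right _ h1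
  ring_nf at *
  omega

theorem value_leaf [Field F] (hK : ∀ g, K.gate (e g) = gate F e g)
    (a : ZMod m) :
    K.value (e (leaf a)) = MonoidAlgebra.single (FreeMonoid.of a) 1 := by
  rw [Circuit.value_eq, hK]
  rfl

theorem value_sum [Field F] (hK : ∀ g, K.gate (e g) = gate F e g)
    (h : Fin (d + 1)) (a : ZMod m) :
    K.value (e (sum h a)) = rootedPoly F h a := by
  induction h using Fin.induction generalizing a with
  | zero =>
    rw [Circuit.value_eq, hK]
    simp only [gate, Fin.cases_zero]
    refine (List.sum_singleton).trans ?_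
    rw [value_leaf hK, Fin.val_zero, rootedPoly_zero]
  | succ h ih =>
    rw [Circuit.value_eq, hK]
    simp only [gate, Fin.cases_succ]
    rw [List.map_map, Finset.sum_map_toList, Fin.val_succ, rootedPoly_succ]
    refine Finset.sum_congr rfl fun b _ => ?_
    rw [Function.comp_apply, Circuit.value_eq, hK]
    simp only [gate, List.map_cons, List.map_nil, List.prod_cons, List.prod_nil, mul_one,
      add_sub_cancel]
    rw [ih, ih, value_leaf hK]
    rfl

theorem circuit_poly [Field F] (hK : ∀ g, K.gate (e g) = gate F e g)
    (hroot : K.root = e out) : K.poly = treePoly F m d := by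
  rw [Circuit.poly, hroot, Circuit.value_eq, hK, treePoly_eq_sum_rootedPoly]
  simp only [gate]
  rw [List.map_map, Finset.sum_map_toList]
  refine Finset.sum_congr rfl fun b _ => ?_
  rw [Function.comp_apply, value_sum hK]
  rfl

/-- The two colours must be allowed to differ for the induction on the level, as a product gate may
be reached with any pair of colours. -/
theorem sameShape_sum (hK : ∀ g, K.gate (e g) = gate F e g)
    (h : Fin (d + 1)) (a a' : ZMod m) {t t' : LTree _}
    (ht : K.IsParseTree (e (sum h a)) t)
    (ht' : K.IsParseTree (e (sum h a')) t') :
    K.SameShape t t' := by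
  have hleaf : ∀ (a a' : ZMod m) (t t' : LTree _),
      K.IsParseTree (e (leaf a)) t →
      K.IsParseTree (e (leaf a')) t' → K.SameShape t t' := by
    intro a a' t t' ht ht'
    rw [ht.eq_of_gate_var (hK _), ht'.eq_of_gate_var (hK _)]
    refine Circuit.sameShape_node ?_ .nil
    rw [hK, hK]
    rfl
  induction h using Fin.induction generalizing a a' t t' with
  | zero =>
    obtain ⟨g, hg, s, hs, rfl⟩ := ht.exists_of_gate_add (hK _)
    obtain ⟨g', hg', s', hs', rfl⟩ := ht'.exists_of_gate_add (hK _)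
    rw [Fin.cases_zero, List.mem_singleton] at hg hg'
    subst hg hg'
    refine Circuit.sameShape_node ?_ (.cons (hleaf _ _ _ _ hs hs') .nil)
    rw [hK, hK]
    rfl
  | succ h ih =>
    obtain ⟨g, hg, s, hs, rfl⟩ := ht.exists_of_gate_add (hK _)
    obtain ⟨g', hg', s', hs', rfl⟩ := ht'.exists_of_gate_add (hK _)
    rw [Fin.cases_succ, List.mem_map] at hg hg'
    obtain ⟨b, -, rfl⟩ := hg
    obtain ⟨b', -, rfl⟩ := hg'
    refine Circuit.sameShape_node ?_ (.cons ?_ .nil)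
    · rw [hK, hK]
      rfl
    obtain ⟨ts, hts, rfl⟩ := hs.exists_of_gate_mul (hK _)
    obtain ⟨ts', hts', rfl⟩ := hs'.exists_of_gate_mul (hK _)
    refine Circuit.sameShape_node ?_ ?_
    · rw [hK, hK]
      rfl
    obtain _ | ⟨h1, _ | ⟨h2, _ | ⟨h3, ⟨⟩⟩⟩⟩ := hts
    obtain _ | ⟨h1', _ | ⟨h2', _ | ⟨h3', ⟨⟩⟩⟩⟩ := hts'
    exact .cons (ih _ _ h1 h1') (.cons (hleaf _ _ _ _ h2 h2') (.cons (ih _ _ h3 h3') .nil))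

theorem isUPT_circuit [Field F] (hK : ∀ g, K.gate (e g) = gate F e g)
    (hroot : K.root = e out) : K.IsUPT := by
  refine ⟨⟨_, circuit_poly hK hroot ▸ isHomogeneous_treePoly F m d⟩, fun t t' ht ht' => ?_⟩
  rw [hroot] at ht ht'
  obtain ⟨g, hg, s, hs, rfl⟩ := ht.exists_of_gate_add (hK _)
  obtain ⟨g', hg', s', hs', rfl⟩ := ht'.exists_of_gate_add (hK _)
  obtain ⟨b, -, rfl⟩ := List.mem_map.1 hg
  obtain ⟨b', -, rfl⟩ := List.mem_map.1 hg'
  exact Circuit.sameShape_node rfl (.cons (sameShape_sum hK _ _ _ hs hs') .nil)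

end TreeGate

theorem exists_circuit (F : Type*) [Field F] (m : ℕ) [NeZero m] {d : ℕ} (hd : 0 < d) :
    ∃ K : Circuit F (ZMod m), K.IsUPT ∧ K.poly = treePoly F m d ∧ K.size ≤ 11 * m ^ 2 * d := by
  obtain ⟨K, e, hroot, hK⟩ := TreeGate.exists_circuit_gate F m d
  exact ⟨K, TreeGate.isUPT_circuit hK hroot, TreeGate.circuit_poly hK hroot,
    TreeGate.circuit_size_le hK hd⟩


/-! ### The bounds in depth `⌊log₂ m⌋` -/

/-- With `d = ⌊log₂ m⌋` and `D = 2 ^ (d + 1) - 1`, quasipolynomials in `m D` are bounded by powers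
`m ^ d`. -/
theorem rpow_logb_mul_le {m d D : ℕ} (hm : 2 ≤ m) (hd : d = Nat.log 2 m)
    (hD : D = 2 ^ (d + 1) - 1) :
    (m * D : ℝ) ^ ((1 / 144 : ℝ) * Real.logb 2 (m * D)) ≤ (m : ℝ) ^ ((1 / 8 : ℝ) * d) := by
  have hm0 : (2 : ℝ) ≤ m := by exact_mod_cast hm
  have hdpos : 1 ≤ d := hd ▸ Nat.log_pos one_lt_two hm
  have hlow : 2 ^ d ≤ m := hd ▸ Nat.pow_log_le_self 2 (by omega)
  have hup : m < 2 ^ (d + 1) := hd ▸ Nat.lt_pow_succ_log_self one_lt_two m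
  have hD1 : 1 ≤ D := by omega
  have hD2 : D ≤ m ^ 2 := by
    rw [pow_succ] at hD
    have h2 : D ≤ 2 * m := by omega
    nlinarith
  have hD1' : (1 : ℝ) ≤ D := by exact_mod_cast hD1
  have hmD1 : (1 : ℝ) ≤ m * D := by nlinarith
  have hmD : (m * D : ℝ) ≤ (m : ℝ) ^ 3 := by
    have : (D : ℝ) ≤ (m : ℝ) ^ 2 := by exact_mod_cast hD2
    nlinarith
  have hlogm : Real.logb 2 m ≤ 2 * d := by
    rw [Real.logb_le_iff_le_rpow one_lt_two (by linarith)]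
    calc (m : ℝ) ≤ (2 : ℝ) ^ (d + 1) := by exact_mod_cast hup.le
      _ ≤ (2 : ℝ) ^ (2 * d) := pow_le_pow_right₀ one_le_two (by omega)
      _ = (2 : ℝ) ^ (2 * d : ℝ) := by rw [← Real.rpow_natCast]; push_cast; rfl
  have hlog : Real.logb 2 (m * D) ≤ 6 * d := by
    calc Real.logb 2 (m * D) ≤ Real.logb 2 ((m : ℝ) ^ 3) :=
          Real.logb_le_logb_of_le one_lt_two (by linarith) hmD
      _ = 3 * Real.logb 2 m := by rw [Real.logb_pow]; norm_num
      _ ≤ 6 * d := by linarith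
  -- The constant is `1 / 8` divided by `6` (from `log₂ (m D) ≤ 6 d`) and by `3` (from `m D ≤ m³`).
  calc (m * D : ℝ) ^ ((1 / 144 : ℝ) * Real.logb 2 (m * D))
      ≤ (m * D : ℝ) ^ ((1 / 24 : ℝ) * d) :=
        Real.rpow_le_rpow_of_exponent_le hmD1 (by linarith)
    _ ≤ ((m : ℝ) ^ 3) ^ ((1 / 24 : ℝ) * d) :=
        Real.rpow_le_rpow (by linarith) hmD (by positivity)
    _ = (m : ℝ) ^ ((1 / 8 : ℝ) * d) := by
        rw [← Real.rpow_natCast, ← Real.rpow_mul (by linarith)]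
        congr 1
        push_cast
        ring

theorem rpow_le_abp (F : Type*) [Field F] (m : ℕ) [NeZero m] {d : ℕ} (hd : 0 < d)
    (σ : Equiv.Perm (Fin (2 ^ (d + 1) - 1))) (A : ABP F (ZMod m))
    (hA : A.poly = shuffle σ (treePoly F m d)) :
    (m : ℝ) ^ ((1 / 8 : ℝ) * d) ≤ A.size ∧
      ∀ L : A.Layering, (m : ℝ) ^ ((1 / 8 : ℝ) * d) ≤ L.width := by
  obtain ⟨d, rfl⟩ := Nat.exists_eq_succ_of_ne_zero hd.ne'
  obtain ⟨t, ht, h⟩ := exists_le_abp F m σ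
  obtain ⟨h1, h2⟩ := h A hA
  have hm : (1 : ℝ) ≤ m := by exact_mod_cast Nat.pos_of_ne_zero (NeZero.ne m)
  have ht' : ((d + 1 : ℕ) : ℝ) ≤ 8 * t := by exact_mod_cast ht
  have hpow : (m : ℝ) ^ ((1 / 8 : ℝ) * (d + 1 : ℕ)) ≤ (m : ℝ) ^ t := by
    rw [← Real.rpow_natCast]
    exact Real.rpow_le_rpow_of_exponent_le hm (by linarith)
  exact ⟨hpow.trans (by exact_mod_cast h1), fun L => hpow.trans (by exact_mod_cast h2 L)⟩

end NCShuffle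

/-! ### The separation -/

theorem mainTheorem6 :
    ∃ (c : ℝ) (C : ℕ), 0 < c ∧
      ∀ (F : Type*) [Field F] (m : ℕ) [NeZero m],
        -- all depths
        (∀ d : ℕ, 0 < d →
          treePoly F m d ≠ 0 ∧ IsHomogeneous (treePoly F m d) (2 ^ (d + 1) - 1) ∧
          (∃ K : Circuit F (ZMod m),
            K.IsUPT ∧ K.poly = treePoly F m d ∧ K.size ≤ C * m ^ 2 * d) ∧
          ∀ (σ : Equiv.Perm (Fin (2 ^ (d + 1) - 1))) (A : ABP F (ZMod m)),
            A.poly = shuffle σ (treePoly F m d) →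
              (m : ℝ) ^ (c * d) ≤ A.size ∧
              ∀ L : A.Layering, (m : ℝ) ^ (c * d) ≤ L.width) ∧
        -- depth `⌊log₂ m⌋`
        (2 ≤ m → ∀ d D : ℕ, d = Nat.log 2 m → D = 2 ^ (d + 1) - 1 →
          (∃ K : Circuit F (ZMod m),
            K.IsUPT ∧ K.poly = treePoly F m d ∧ (K.size : ℝ) ≤ C * m ^ 2 * Real.logb 2 m ∧
            K.preimageWidth ≤ (m * D) ^ C) ∧
          ∀ (σ : Equiv.Perm (Fin D)) (A : ABP F (ZMod m)),
            A.poly = shuffle σ (treePoly F m d) →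
              (m * D : ℝ) ^ (c * Real.logb 2 (m * D)) ≤ A.size ∧
              ∀ L : A.Layering, (m * D : ℝ) ^ (c * Real.logb 2 (m * D)) ≤ L.width) := by
  refine ⟨1 / 144, 11, by norm_num, fun F _ m _ => ⟨fun d hd => ?_, fun hm d D hdm hD => ?_⟩⟩
  · have hm1 : (1 : ℝ) ≤ m := by exact_mod_cast Nat.pos_of_ne_zero (NeZero.ne m)
    have hle : (m : ℝ) ^ ((1 / 144 : ℝ) * d) ≤ (m : ℝ) ^ ((1 / 8 : ℝ) * d) :=
      Real.rpow_le_rpow_of_exponent_le hm1 (by gcongr; norm_num)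
    refine ⟨treePoly_ne_zero F m d, isHomogeneous_treePoly F m d, exists_circuit F m hd,
      fun σ A hA => ?_⟩
    obtain ⟨h1, h2⟩ := rpow_le_abp F m hd σ A hA
    exact ⟨hle.trans h1, fun L => hle.trans (h2 L)⟩
  · have hd : 0 < d := hdm ▸ Nat.log_pos one_lt_two hm
    have hle := rpow_logb_mul_le hm hdm hD
    refine ⟨?_, ?_⟩
    · obtain ⟨K, hK, hpoly, hsize⟩ := exists_circuit F m hd
      refine ⟨K, hK, hpoly, ?_, ?_⟩
      · have hlog : (d : ℝ) ≤ Real.logb 2 m := by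
          rw [hdm]
          exact Real.natLog_le_logb m 2
        calc (K.size : ℝ) ≤ ((11 * m ^ 2 * d : ℕ) : ℝ) := by exact_mod_cast hsize
          _ = (11 : ℕ) * (m : ℝ) ^ 2 * d := by push_cast; ring
          _ ≤ _ := by gcongr
      · have hdD : d ≤ D := by
          have := Nat.lt_two_pow_self (n := d + 1)
          omega
        have hD3 : 3 ≤ D := by
          have := Nat.pow_le_pow_right two_pos (show 2 ≤ d + 1 by omega)
          omega
        calc K.preimageWidth ≤ K.numGates := K.preimageWidth_le_numGates
          _ ≤ K.size := Nat.le_add_right _ _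
          _ ≤ 11 * m ^ 2 * d := hsize
          -- Here `11 ≤ (m D)²` because `m D ≥ 6`, and `d ≤ D ≤ D²`; the exponent `4` is then raised
          -- to the common constant `11`.
          _ ≤ (m * D) ^ 2 * m ^ 2 * D ^ 2 := by
            gcongr
            · have : 2 * 3 ≤ m * D := Nat.mul_le_mul hm hD3
              nlinarith
            · nlinarith
          _ = (m * D) ^ 4 := by ring
          _ ≤ (m * D) ^ 11 := Nat.pow_le_pow_right (by positivity) (by norm_num)
    · subst hD
      intro σ A hA
      obtain ⟨h1, h2⟩ := rpow_le_abp F m hd σ A hA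
      exact ⟨hle.trans h1, fun L => hle.trans (h2 L)⟩
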